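/- For an integer $n\ge 1$ the balanced hypercube $BH_n$ is the simple graph with vertex set $(\mathbb{Z}/4)^n$ in which a vertex $(a_0,a_1,\ldots,a_{n-1})$ is adjacent to the $2n$ vertices $(a_0\pm1,a_1,\ldots,a_{n-1})$ and $(a_0\pm1,a_1,\ldots,a_{i-1},a_i+(-1)^{a_0},a_{i+1},\ldots,a_{n-1})$, $1\le i\le n-1$ (coordinates modulo $4$). For graphs $G$ and $H$, an $H$-substructure-cut of $G$ is a set $F$ of pairwise vertex-disjoint connected subgraphs of $G$, each isomorphic to a connected subgraph of $H$, such that $G-V(F)$ is disconnected or trivial (has at most one vertex), where $V(F)$ is the union of the vertex sets of the members of $F$. The $H$-substructure-connectivity $\kappa^s(G;H)$ is the minimum cardinality of an $H$-substructure-cut of $G$ (and $\infty$ if there is no finite one). **Theorem.** For every integer $n\ge 2$, $\kappa^s(BH_n;K_{1,3})=n$. -/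

import Mathlib

namespace StructureConnectivity

/-- A family `F` of subgraphs of `G` is an `H`-substructure-cut of `G` if its members are pairwise
vertex-disjoint connected subgraphs of `G`, each isomorphic to a connected subgraph of `H`, and
`G - V(F)` is disconnected or trivial (has at most one vertex). -/
structure IsSubstructureCut {V W : Type*} (G : SimpleGraph V) (H : SimpleGraph W)
    (F : Set G.Subgraph) : Prop where
  connected : ∀ T ∈ F, T.Connected
  iso_subgraph : ∀ T ∈ F, ∃ S : H.Subgraph, S.Connected ∧ Nonempty (T.coe ≃g S.coe)
  disjoint : F.Pairwise fun T T' => Disjoint T.verts T'.verts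
  cut : ¬ (G.induce (⋃ T ∈ F, T.verts)ᶜ).Preconnected ∨ ((⋃ T ∈ F, T.verts)ᶜ).Subsingleton

/-- The `H`-substructure-connectivity `κˢ(G; H)`: the minimum cardinality of an
`H`-substructure-cut of `G` (and `⊤` if there is no finite one). -/
noncomputable def substructureConnectivity {V W : Type*} (G : SimpleGraph V)
    (H : SimpleGraph W) : ℕ∞ :=
  ⨅ (F : Set G.Subgraph) (_ : IsSubstructureCut G H F), F.encard

end StructureConnectivity

namespace BalancedHypercube

/-- The directed form of adjacency: `v` is one of the `2n` listed neighbours of `u`.  The inner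
index changes by `e = ±1`; at most one outer index `i` changes, by `(-1)^{u 0}`. -/
def IsNeighbor {n : ℕ} [NeZero n] (u v : Fin n → ZMod 4) : Prop :=
  ∃ e : ZMod 4, (e = 1 ∨ e = -1) ∧
    (v = Function.update u 0 (u 0 + e) ∨
      ∃ i : Fin n, i ≠ 0 ∧
        v = Function.update (Function.update u 0 (u 0 + e)) i (u i + (-1) ^ (u 0).val))

theorem sign_flip (a e : ZMod 4) (he : e = 1 ∨ e = -1) :
    (-1 : ZMod 4) ^ (a + e).val = -(-1) ^ a.val := by
  revert a e
  decide

theorem IsNeighbor.symm {n : ℕ} [NeZero n] {u v : Fin n → ZMod 4} (h : IsNeighbor u v) :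
    IsNeighbor v u := by
  obtain ⟨e, he, h⟩ := h
  have he' : -e = 1 ∨ -e = -1 := by
    rcases he with rfl | rfl <;> simp
  refine ⟨-e, he', ?_⟩
  rcases h with rfl | ⟨i, hi, rfl⟩
  · left
    simp
  · right
    refine ⟨i, hi, ?_⟩
    have hs := sign_flip (u 0) e he
    funext j
    by_cases hj : j = i
    · subst hj
      simp [Function.update_of_ne hi.symm, hs]
    · by_cases hj0 : j = 0
      · subst hj0
        simp [Function.update_of_ne hj]
      · simp [Function.update_of_ne hj, Function.update_of_ne hj0]

theorem IsNeighbor.irrefl {n : ℕ} [NeZero n] (u : Fin n → ZMod 4) : ¬ IsNeighbor u u := by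
  rintro ⟨e, he, h⟩
  have he0 : e ≠ 0 := by
    rcases he with rfl | rfl <;> decide
  rcases h with h | ⟨i, hi, h⟩
  · have := congrFun h 0
    simp [he0] at this
  · have := congrFun h 0
    simp [Function.update_of_ne hi.symm, he0] at this

/-- The `n`-dimensional balanced hypercube `BH_n` (`n ≥ 1`). -/
def BH (n : ℕ) [NeZero n] : SimpleGraph (Fin n → ZMod 4) where
  Adj := IsNeighbor
  symm := ⟨fun _ _ h => h.symm⟩
  loopless := ⟨IsNeighbor.irrefl⟩

end BalancedHypercube

/-! Write `n = m + 1`. Two vertices that differ by 2 in the inner coordinate have the same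
neighbours, so `BH (m + 1)` arises from the graph of twin classes by doubling every vertex. This
graph is bipartite, `(m + 1)`-regular and free of 4-cycles (`eq_of_nbr_eq_nbr`).

Upper bound: for each of the `m + 1` classes next to a class `q`, take a path with three vertices
whose ends are the two twins and whose centre avoids `q`. These paths isolate both vertices of `q`,
and the absence of 4-cycles makes them disjoint.

Lower bound: `m` stars have at most `4 * m` vertices, so the set `D` of fully covered classes has at
most `2 * m` elements. A star has at most two more vertices next to a class than inside it, so no
surviving class is isolated; hence surviving twins stay connected and only the class graph matters.
For `2 ≤ m`, all but two classes outside `D` lie in one component (`IsColoring.exists_small`), so a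
disconnection cuts off an edge. Its `2 * m` neighbouring classes are independent, so a star contains
at most 3 of their `4 * m` vertices, which is too few. For `m = 1`, `D` has at most one class and
`IsColoring.exists_eq` applies.

Connectedness is expressed by colourings constant along surviving edges, since these restrict
directly to subcubes. -/

namespace BalancedHypercube

/-! ### The graph of twin classes and its lack of 4-cycles. -/

/-- The displacement between a twin class with even inner index and its neighbours. -/
def step {m : ℕ} : Option (Fin m) → Fin m → ZMod 4
  | none => 0
  | some i => Pi.single i 1

/-- Classes of vertices of `BH_(m+1)` with equal neighbourhoods: parity of the inner index and the
outer indices. -/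
abbrev TwinClass (m : ℕ) : Type := Bool × (Fin m → ZMod 4)

/-- The `m + 1` neighbours of a twin class. -/
def nbr {m : ℕ} (x : TwinClass m) (t : Option (Fin m)) : TwinClass m :=
  (!x.1, if x.1 then x.2 - step t else x.2 + step t)

theorem step_apply {m : ℕ} (t : Option (Fin m)) (i : Fin m) :
    step t i = if t = some i then 1 else 0 := by
  cases t with
  | none => simp [step]
  | some j => simp [step, Pi.single_apply, eq_comm]

theorem step_injective {m : ℕ} : Function.Injective (step (m := m)) := by
  have h1 : (1 : ZMod 4) ≠ 0 := by decide
  intro t s h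
  ext i
  have := congrFun h i
  rw [step_apply, step_apply] at this
  by_cases ht : t = some i <;> by_cases hs : s = some i <;> simp_all

/-- Steps are 0 or unit vectors and `1 + 1 ≠ 0` modulo 4, so a sum of two steps determines the
unordered pair. -/
theorem step_add_eq {m : ℕ} {t s t' s' : Option (Fin m)} (h : step t + step s' = step t' + step s)
    (hts : t ≠ s) : t = t' := by
  have h1 : (1 : ZMod 4) ≠ 0 := by decide
  have h2 : (1 : ZMod 4) + 1 ≠ 0 := by decide
  have key : ∀ i, (step t i + step s' i : ZMod 4) = step t' i + step s i := fun i => congrFun h i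
  simp only [step_apply] at key
  by_contra htt
  cases t with
  | some i =>
    have := key i
    simp only [if_neg (Ne.symm hts), if_neg (Ne.symm htt)] at this
    split_ifs at this <;> simp_all
  | none =>
    obtain ⟨j, rfl⟩ := Option.ne_none_iff_exists'.1 (Ne.symm htt)
    by_cases hs' : s' = some j
    · subst hs'
      rw [add_comm] at h
      exact hts (step_injective (add_left_cancel h))
    · have := key j
      simp only [if_neg hs'] at this
      split_ifs at this <;> simp_all

theorem nbr_nbr {m : ℕ} (x : TwinClass m) (t : Option (Fin m)) : nbr (nbr x t) t = x := by
  obtain ⟨p, a⟩ := x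
  cases p <;> simp [nbr]

theorem nbr_fst {m : ℕ} (x : TwinClass m) (t : Option (Fin m)) : (nbr x t).1 = !x.1 := rfl

theorem nbr_injective {m : ℕ} (x : TwinClass m) : Function.Injective (nbr x) := by
  obtain ⟨p, a⟩ := x
  intro t s h
  apply step_injective
  cases p <;> simpa [nbr] using h

theorem eq_nbr_comm {m : ℕ} {x y : TwinClass m} {t : Option (Fin m)} :
    y = nbr x t ↔ x = nbr y t :=
  ⟨fun h => by rw [h, nbr_nbr], fun h => by rw [h, nbr_nbr]⟩

/-- There are no 4-cycles among twin classes. -/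
theorem eq_of_nbr_eq_nbr {m : ℕ} {x y : TwinClass m} {t s t' s' : Option (Fin m)} (hxy : x ≠ y)
    (h : nbr x t = nbr y s) (h' : nbr x t' = nbr y s') : t = t' := by
  have hts : t ≠ s := by
    rintro rfl
    apply hxy
    rw [← nbr_nbr x t, h, nbr_nbr]
  obtain ⟨p, a⟩ := x
  obtain ⟨q, b⟩ := y
  have hpq : p = q := by
    have := congrArg Prod.fst h
    simpa [nbr] using this
  subst hpq
  -- Combining the two equations cancels the base points `a` and `b`.
  refine step_add_eq (s' := s') ?_ hts
  cases p
  · simp only [nbr, Bool.not_false, Bool.false_eq_true, if_false, Prod.mk.injEq, true_and] at h h'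
    have e : step t + step s' + (a + b) = step t' + step s + (a + b) := by
      calc step t + step s' + (a + b) = (a + step t) + (b + step s') := by abel
        _ = (b + step s) + (a + step t') := by rw [h, h']
        _ = _ := by abel
    exact add_right_cancel e
  · simp only [nbr, Bool.not_true, if_true, Prod.mk.injEq, true_and] at h h'
    have e : a + b - (step t + step s') = a + b - (step t' + step s) := by
      calc a + b - (step t + step s') = (a - step t) + (b - step s') := by abel
        _ = (b - step s) + (a - step t') := by rw [h, h']
        _ = _ := by abel
    exact sub_right_injective e

/-- The neighbourhood of a twin class. -/
def nbrs {m : ℕ} (x : TwinClass m) : Finset (TwinClass m) := Finset.univ.image (nbr x)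

theorem mem_nbrs {m : ℕ} {x y : TwinClass m} : y ∈ nbrs x ↔ ∃ t, nbr x t = y := by
  simp [nbrs]

theorem card_nbrs {m : ℕ} (x : TwinClass m) : (nbrs x).card = m + 1 := by
  rw [nbrs, Finset.card_image_of_injective _ (nbr_injective x)]
  simp

theorem card_nbrs_inter {m : ℕ} {x y : TwinClass m} (h : x ≠ y) :
    (nbrs x ∩ nbrs y).card ≤ 1 := by
  rw [Finset.card_le_one]
  simp only [Finset.mem_inter, mem_nbrs]
  rintro _ ⟨⟨t, rfl⟩, s, hs⟩ _ ⟨⟨t', rfl⟩, s', hs'⟩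
  rw [eq_of_nbr_eq_nbr h hs.symm hs'.symm]

theorem card_nbrs_union {m : ℕ} {x y : TwinClass m} (h : x ≠ y) :
    2 * m + 1 ≤ (nbrs x ∪ nbrs y).card := by
  have := Finset.card_union_add_card_inter (nbrs x) (nbrs y)
  have := card_nbrs_inter h
  rw [card_nbrs, card_nbrs] at *
  omega

/-! ### Splitting along the first outer coordinate into four copies. -/

/-- The `k`-th copy of a twin class of dimension `m` in dimension `m + 1`. -/
def ins {m : ℕ} (k : ZMod 4) (x : TwinClass m) : TwinClass (m + 1) := (x.1, Fin.cons k x.2)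

theorem ins_inj {m : ℕ} {k l : ZMod 4} {x y : TwinClass m} :
    ins k x = ins l y ↔ k = l ∧ x = y := by
  simp only [ins, Prod.ext_iff, Fin.cons_inj]
  tauto

theorem exists_ins {m : ℕ} (v : TwinClass (m + 1)) : ∃ k x, v = ins k x :=
  ⟨v.2 0, (v.1, Fin.tail v.2), by simp [ins]⟩

theorem step_none {m : ℕ} : step (none : Option (Fin m)) = 0 := rfl

theorem nbr_ins {m : ℕ} (k : ZMod 4) (x : TwinClass m) (t : Option (Fin m)) :
    nbr (ins k x) (t.map Fin.succ) = ins k (nbr x t) := by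
  have : step (t.map Fin.succ) = Fin.cons 0 (step t) := by
    ext i
    refine Fin.cases ?_ (fun j => ?_) i
    · cases t <;> simp [step_apply, Fin.succ_ne_zero]
    · cases t <;> simp [step_apply]
  simp only [nbr, ins, this, Prod.mk.injEq, true_and]
  split_ifs
  · funext i
    refine Fin.cases ?_ (fun j => ?_) i <;> simp
  · funext i
    refine Fin.cases ?_ (fun j => ?_) i <;> simp

/-- The direction in which a twin class of the given parity leaves its copy. -/
def sgn (p : Bool) : ZMod 4 := if p then -1 else 1

/-- The four copies form a cycle: the even classes of a copy are matched with the odd classes of the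
next one. -/
theorem nbr_ins_zero {m : ℕ} (k : ZMod 4) (x : TwinClass m) :
    nbr (ins k x) (some 0) = ins (k + sgn x.1) (nbr x none) := by
  obtain ⟨p, a⟩ := x
  cases p
  · simp only [nbr, ins, sgn, step_none, Bool.false_eq_true, if_false, Prod.mk.injEq, true_and]
    funext i
    refine Fin.cases ?_ (fun j => ?_) i
    · simp [step]
    · simp [step, Fin.succ_ne_zero]
  · simp only [nbr, ins, sgn, step_none, if_true, Prod.mk.injEq, true_and]
    funext i
    refine Fin.cases ?_ (fun j => ?_) i
    · simp [step, sub_eq_add_neg]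
    · simp [step, Fin.succ_ne_zero]

/-- The part of `D` in the `k`-th copy. -/
def slice {m : ℕ} (D : Finset (TwinClass (m + 1))) (k : ZMod 4) : Finset (TwinClass m) :=
  Finset.univ.filter fun x => ins k x ∈ D

theorem mem_slice {m : ℕ} {D : Finset (TwinClass (m + 1))} {k : ZMod 4} {x : TwinClass m} :
    x ∈ slice D k ↔ ins k x ∈ D := by
  simp [slice]

theorem sum_card_slice {m : ℕ} (D : Finset (TwinClass (m + 1))) :
    ∑ k, (slice D k).card = D.card := by
  rw [Finset.card_eq_sum_card_fiberwise (f := fun v => v.2 0) (t := Finset.univ)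
    (fun _ _ => by simp)]
  refine Finset.sum_congr rfl fun k _ => ?_
  refine Finset.card_bij (fun x _ => ins k x) ?_ ?_ ?_
  · intro x hx
    simpa [ins] using mem_slice.1 hx
  · intro x _ y _ h
    exact (ins_inj.1 h).2
  · intro v hv
    obtain ⟨l, x, rfl⟩ := exists_ins v
    simp only [Finset.mem_filter] at hv
    obtain ⟨h, rfl⟩ := hv
    exact ⟨x, by simpa [mem_slice, ins] using h, by simp [ins]⟩

theorem sum_zmod_four (f : ZMod 4 → ℕ) : ∑ k, f k = f 0 + f 1 + f 2 + f 3 :=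
  Fin.sum_univ_four f

theorem sum_card_slice_shift {m : ℕ} (D : Finset (TwinClass (m + 1))) (k : ZMod 4) :
    (slice D k).card + (slice D (k + 1)).card + (slice D (k + 2)).card + (slice D (k + 3)).card
      = D.card := by
  rw [← sum_card_slice, ← Equiv.sum_comp (Equiv.addLeft k)]
  simp only [Equiv.coe_addLeft]
  rw [sum_zmod_four, add_zero]

/-! ### Colourings and connectivity of the class graph. -/

/-- `c` is constant along edges that avoid `D`. -/
def IsColoring {m : ℕ} {α : Type*} (D : Finset (TwinClass m)) (c : TwinClass m → α) : Prop :=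
  ∀ x t, x ∉ D → nbr x t ∉ D → c (nbr x t) = c x

/-- Outside `D`, the `k`-th copy has the single colour `b`. -/
def IsMono {m : ℕ} {α : Type*} (D : Finset (TwinClass (m + 1))) (c : TwinClass (m + 1) → α)
    (k : ZMod 4) (b : α) : Prop :=
  ∀ x, ins k x ∉ D → c (ins k x) = b

theorem IsColoring.slice {m : ℕ} {α : Type*} {D : Finset (TwinClass (m + 1))}
    {c : TwinClass (m + 1) → α} (hc : IsColoring D c) (k : ZMod 4) :
    IsColoring (slice D k) fun x => c (ins k x) := by
  intro x t hx ht
  rw [mem_slice] at hx ht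
  have := hc (ins k x) (t.map Fin.succ) hx
  rw [nbr_ins] at this
  exact this ht

theorem two_mul_lt_four_pow (m : ℕ) : 2 * m < 4 ^ m := by
  induction m with
  | zero => simp
  | succ k ih => rw [pow_succ]; have := Nat.one_le_pow k 4 (by norm_num); omega

/-- A matching indexed by the even twin classes is not destroyed by few vertices. -/
theorem exists_not_mem_not_mem {m : ℕ} (A B : Finset (TwinClass m))
    (h : A.card + B.card < 4 ^ m) :
    ∃ x : TwinClass m, x.1 = false ∧ x ∉ A ∧ nbr x none ∉ B := by
  classical
  by_contra! hcon
  let E : Finset (TwinClass m) := Finset.univ.image fun a : Fin m → ZMod 4 => (false, a)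
  have hE : E.card = 4 ^ m := by
    rw [Finset.card_image_of_injective _ (fun a b h => (Prod.mk.inj h).2)]
    simp [ZMod.card]
  have hsub : E ⊆ A ∪ B.image fun y => nbr y none := by
    intro x hx
    simp only [E, Finset.mem_image, Finset.mem_univ, true_and] at hx
    obtain ⟨a, rfl⟩ := hx
    by_cases hA : (false, a) ∈ A
    · exact Finset.mem_union_left _ hA
    · exact Finset.mem_union_right _ (Finset.mem_image.2 ⟨_, hcon _ rfl hA, nbr_nbr _ _⟩)
  have h1 := Finset.card_le_card hsub
  have h2 := Finset.card_union_le A (B.image fun y => nbr y none)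
  have h3 : (B.image fun y => nbr y none).card ≤ B.card := Finset.card_image_le
  omega

/-- At most `2 * m` deleted classes cannot hit all `4 ^ m` matching edges between consecutive
copies. -/
theorem IsMono.link {m : ℕ} {α : Type*} {D : Finset (TwinClass (m + 1))}
    {c : TwinClass (m + 1) → α} (hc : IsColoring D c) {k l : ZMod 4} {b b' : α} (hl : k + 1 = l)
    (hk : (BalancedHypercube.slice D k).card ≤ m) (hk' : (BalancedHypercube.slice D l).card ≤ m)
    (h : IsMono D c k b) (h' : IsMono D c l b') : b = b' := by
  subst hl
  obtain ⟨x, hx, hA, hB⟩ := exists_not_mem_not_mem (BalancedHypercube.slice D k)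
    (BalancedHypercube.slice D (k + 1)) (by have := two_mul_lt_four_pow m; omega)
  rw [mem_slice] at hA hB
  have h1 := hc (ins k x) (some 0) hA
  rw [nbr_ins_zero, hx] at h1
  rw [← h x hA, ← h' _ hB]
  exact (h1 hB).symm

theorem not_mem_of_card_eq_zero {m : ℕ} {D : Finset (TwinClass (m + 1))} {k : ZMod 4}
    (h : (slice D k).card = 0) (x : TwinClass m) : ins k x ∉ D := by
  rw [← mem_slice, Finset.card_eq_zero.1 h]
  simp

theorem zmod_four_cases (k l : ZMod 4) : l = k ∨ l = k + 1 ∨ l = k + 2 ∨ l = k + 3 := by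
  revert k l
  decide

theorem zmod_four_add_ne (k : ZMod 4) : k + 1 ≠ k ∧ k + 2 ≠ k ∧ k + 3 ≠ k := by
  revert k
  decide

/-- If every copy of dimension `m` loses at most `m` classes, with the exception of the `k`-th
one, then all the other copies get the same colour. -/
theorem exists_isMono_of_ne {m : ℕ} {α : Type*} {D : Finset (TwinClass (m + 1))}
    {c : TwinClass (m + 1) → α} (hc : IsColoring D c)
    (ih : ∀ k, (slice D k).card ≤ m → ∃ b, IsMono D c k b) (k : ZMod 4)
    (hk : ∀ l, l ≠ k → (slice D l).card ≤ m) : ∃ b, ∀ l, l ≠ k → IsMono D c l b := by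
  obtain ⟨n1, n2, n3⟩ := zmod_four_add_ne k
  obtain ⟨b, h1⟩ := ih (k + 1) (hk _ n1)
  obtain ⟨b2, h2⟩ := ih (k + 2) (hk _ n2)
  obtain ⟨b3, h3⟩ := ih (k + 3) (hk _ n3)
  -- The three copies other than the `k`-th form a path, so two links suffice.
  have e1 := IsMono.link hc (by ring) (hk _ n1) (hk _ n2) h1 h2
  have e2 := IsMono.link hc (by ring) (hk _ n2) (hk _ n3) h2 h3
  subst e2 e1
  refine ⟨b, fun l hl => ?_⟩
  rcases zmod_four_cases k l with rfl | rfl | rfl | rfl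
  exacts [absurd rfl hl, h1, h2, h3]

theorem exists_isMono {m : ℕ} {α : Type*} {D : Finset (TwinClass (m + 1))}
    {c : TwinClass (m + 1) → α} (hc : IsColoring D c)
    (ih : ∀ k, (slice D k).card ≤ m → ∃ b, IsMono D c k b)
    (h : ∀ l, (slice D l).card ≤ m) : ∃ b, ∀ l, IsMono D c l b := by
  obtain ⟨b, hb⟩ := exists_isMono_of_ne hc ih 0 fun l _ => h l
  obtain ⟨b', hb'⟩ := ih 0 (h 0)
  have e := IsMono.link hc (k := 0) (l := 1) (by decide) (h _) (h _) hb' (hb 1 (by decide))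
  subst e
  refine ⟨b', fun l => ?_⟩
  by_cases hl : l = 0
  · exact hl ▸ hb'
  · exact hb l hl

theorem sgn_ne (k : ZMod 4) (p : Bool) : k + sgn p ≠ k := by
  revert k p
  decide

/-- The graph of twin classes is `(m + 1)`-connected. -/
theorem IsColoring.exists_eq {m : ℕ} {α : Type*} {D : Finset (TwinClass m)}
    {c : TwinClass m → α} (hc : IsColoring D c) (hD : D.card ≤ m) :
    ∃ b, ∀ x, x ∉ D → c x = b := by
  induction m with
  | zero =>
    -- In dimension 0 the class graph is a single edge.
    have hD0 : D = ∅ := by simpa using hD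
    subst hD0
    refine ⟨c (false, 0), ?_⟩
    rintro ⟨p, a⟩ -
    rw [Subsingleton.elim a 0]
    cases p
    · rfl
    · rw [← hc (false, 0) none (by simp) (by simp)]
      rfl
  | succ m ih =>
    have ih' : ∀ k, (BalancedHypercube.slice D k).card ≤ m → ∃ b, IsMono D c k b := by
      intro k hk
      obtain ⟨b, hb⟩ := ih (hc.slice k) hk
      exact ⟨b, fun x hx => hb x (mt mem_slice.1 hx)⟩
    by_cases hall : ∀ l, (BalancedHypercube.slice D l).card ≤ m
    · obtain ⟨b, hb⟩ := exists_isMono hc ih' hall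
      refine ⟨b, fun v hv => ?_⟩
      obtain ⟨k, x, rfl⟩ := exists_ins v
      exact hb k x hv
    · push Not at hall
      obtain ⟨k, hk⟩ := hall
      -- Copy `k` contains more than `m` of at most `m + 1` deleted classes, hence all of `D`; each
      -- of its surviving classes has a neighbour in an intact copy.
      have hs := sum_card_slice_shift D k
      have hz : ∀ l, l ≠ k → (BalancedHypercube.slice D l).card = 0 := by
        intro l hl
        rcases zmod_four_cases k l with rfl | rfl | rfl | rfl
        · exact absurd rfl hl
        all_goals omega
      obtain ⟨b, hb⟩ := exists_isMono_of_ne hc ih' k fun l hl => by rw [hz l hl]; omega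
      refine ⟨b, fun v hv => ?_⟩
      obtain ⟨l, x, rfl⟩ := exists_ins v
      by_cases hl : l = k
      · subst hl
        have hn := not_mem_of_card_eq_zero (hz _ (sgn_ne l x.1)) (nbr x none)
        rw [← hb _ (sgn_ne l x.1) _ hn, ← nbr_ins_zero]
        refine (hc _ _ hv ?_).symm
        rwa [nbr_ins_zero]
      · exact hb l hl x hv

/-! ### Deleting at most `2m` classes. -/

/-- If all classes outside the `k`-th copy have colour `b`, then a class of the `k`-th copy with
another colour is determined by its parity, if `D` is small. -/
theorem IsColoring.eq_of_fst_eq {m : ℕ} {α : Type*} {D : Finset (TwinClass (m + 1))}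
    {c : TwinClass (m + 1) → α} (hc : IsColoring D c) (hD : D.card ≤ 2 * (m + 1)) {k : ZMod 4}
    {b : α} (hb : ∀ l, l ≠ k → IsMono D c l b) {x y : TwinClass m} (hx : ins k x ∉ D)
    (hxb : c (ins k x) ≠ b) (hy : ins k y ∉ D) (hyb : c (ins k y) ≠ b) (hxy : x.1 = y.1) :
    x = y := by
  classical
  by_contra hne
  let R : Finset (TwinClass m) := Finset.univ.filter fun x => ins k x ∉ D ∧ c (ins k x) ≠ b
  have hR : ∀ z, z ∈ R ↔ ins k z ∉ D ∧ c (ins k z) ≠ b := by simp [R]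
  -- A class in `R` has its neighbour outside copy `k` in `D`, as otherwise it would have colour
  -- `b`; these neighbours are distinct.
  have hcard : (BalancedHypercube.slice D k).card + R.card ≤ D.card := by
    have hi1 : Function.Injective fun z : TwinClass m => ins k z := fun z w h => (ins_inj.1 h).2
    have hi2 : Function.Injective fun z : TwinClass m => nbr (ins k z) (some 0) := by
      intro z w h
      apply hi1
      have := congrArg (fun v => nbr v (some 0)) h
      simpa only [nbr_nbr] using this
    rw [← Finset.card_image_of_injective _ hi1, ← Finset.card_image_of_injective R hi2,
      ← Finset.card_union_of_disjoint]
    · apply Finset.card_le_card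
      intro v hv
      rcases Finset.mem_union.1 hv with hv | hv
      · obtain ⟨z, hz, rfl⟩ := Finset.mem_image.1 hv
        exact mem_slice.1 hz
      · obtain ⟨z, hz, rfl⟩ := Finset.mem_image.1 hv
        by_contra hn
        obtain ⟨h1, h2⟩ := (hR z).1 hz
        apply h2
        rw [← hc _ _ h1 hn]
        rw [nbr_ins_zero] at hn ⊢
        exact hb _ (sgn_ne _ _) _ hn
    · rw [Finset.disjoint_left]
      intro v hv hv'
      obtain ⟨z, -, rfl⟩ := Finset.mem_image.1 hv
      obtain ⟨w, -, h⟩ := Finset.mem_image.1 hv'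
      rw [nbr_ins_zero, ins_inj] at h
      exact sgn_ne _ _ h.1
  have hxR : x ∈ R := (hR x).2 ⟨hx, hxb⟩
  have hyR : y ∈ R.erase x := Finset.mem_erase.2 ⟨Ne.symm hne, (hR y).2 ⟨hy, hyb⟩⟩
  have key : ∀ z ∈ R, ∀ t, nbr z t ∈ BalancedHypercube.slice D k ∪ R := by
    intro z hz t
    rw [Finset.mem_union, mem_slice, hR]
    by_contra! hcon
    obtain ⟨h1, h2⟩ := (hR z).1 hz
    have h3 := hc.slice k z t (mt mem_slice.1 h1) (mt mem_slice.1 hcon.1)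
    exact h2 (h3.symm.trans (hcon.2 hcon.1))
  -- Neighbours of `x` and `y` have the opposite parity, so they avoid `x` and `y` themselves.
  -- Counting then gives `2 * m + 1 ≤ D.card - 2 ≤ 2 * m`.
  have hsub : nbrs x ∪ nbrs y ⊆ BalancedHypercube.slice D k ∪ (R.erase x).erase y := by
    intro w hw
    have hwp : w.1 = !x.1 ∧ w ∈ BalancedHypercube.slice D k ∪ R := by
      rcases Finset.mem_union.1 hw with hw | hw
      · obtain ⟨t, rfl⟩ := mem_nbrs.1 hw
        exact ⟨rfl, key x hxR t⟩
      · obtain ⟨t, rfl⟩ := mem_nbrs.1 hw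
        exact ⟨by rw [hxy]; rfl, key y (Finset.mem_of_mem_erase hyR) t⟩
    have hwx : w ≠ x := by rintro rfl; simpa using hwp.1
    have hwy : w ≠ y := by rintro rfl; rw [hxy] at hwp; simpa using hwp.1
    have := hwp.2
    simp only [Finset.mem_union, Finset.mem_erase] at this ⊢
    tauto
  have h1 := Finset.card_le_card hsub
  have h2 := Finset.card_union_le (BalancedHypercube.slice D k) ((R.erase x).erase y)
  have h3 := card_nbrs_union hne
  have h4 := Finset.card_erase_add_one hxR
  have h5 := Finset.card_erase_add_one hyR
  omega

/-- A copy that has lost at most `m + 1` classes, and one of whose neighbouring copies is intact,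
has at most one vertex whose colour differs from that of the neighbouring copy. -/
theorem IsColoring.eq_of_isMono {m : ℕ} {α : Type*} {D : Finset (TwinClass (m + 1))}
    {c : TwinClass (m + 1) → α} (hc : IsColoring D c) (hm : 1 ≤ m) {k : ZMod 4}
    (hk : (BalancedHypercube.slice D k).card ≤ m + 1) {p : Bool}
    (hp : (BalancedHypercube.slice D (k + sgn p)).card = 0) {b : α}
    (hb : IsMono D c (k + sgn p) b) {x y : TwinClass m} (hx : ins k x ∉ D)
    (hxb : c (ins k x) ≠ b) (hy : ins k y ∉ D) (hyb : c (ins k y) ≠ b) : x = y := by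
  classical
  by_contra hne
  -- Classes of parity `p` have a neighbour in the intact copy. A class of another colour thus has
  -- parity `!p`, and all its neighbours in the copy must be deleted; two such classes need `2 * m +
  -- 1 > m + 1` deletions.
  have side : ∀ z : TwinClass m, ins k z ∉ D → z.1 = p → c (ins k z) = b := by
    rintro z hz rfl
    have hn := not_mem_of_card_eq_zero hp (nbr z none)
    rw [← hb _ hn, ← nbr_ins_zero]
    rw [← nbr_ins_zero] at hn
    exact (hc _ _ hz hn).symm
  have key : ∀ z : TwinClass m, ins k z ∉ D → c (ins k z) ≠ b →
      nbrs z ⊆ BalancedHypercube.slice D k := by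
    intro z hz hzb w hw
    obtain ⟨t, rfl⟩ := mem_nbrs.1 hw
    by_contra hn
    apply hzb
    refine (hc.slice k z t (mt mem_slice.1 hz) hn).symm.trans (side _ (mt mem_slice.2 hn) ?_)
    have : z.1 ≠ p := fun h => hzb (side z hz h)
    rw [nbr_fst]
    revert this
    cases z.1 <;> cases p <;> simp
  have h1 := Finset.card_le_card (Finset.union_subset (key x hx hxb) (key y hy hyb))
  have h2 := card_nbrs_union hne
  omega

/-- Each class lies on one edge of the matching in direction `none`. Splitting `A` by parity avoids
counting its elements twice. -/
theorem exists_not_mem_nbr_not_mem {m : ℕ} (A : Finset (TwinClass m)) (h : A.card < 4 ^ m) :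
    ∃ x : TwinClass m, x.1 = false ∧ x ∉ A ∧ nbr x none ∉ A := by
  obtain ⟨x, hx, h1, h2⟩ := exists_not_mem_not_mem (A.filter fun x => x.1 = false)
    (A.filter fun x => ¬ x.1 = false) (by rwa [Finset.card_filter_add_card_filter_not])
  refine ⟨x, hx, fun h => h1 (by simp [h, hx]), fun h => h2 ?_⟩
  simp [h, nbr_fst, hx]

/-- If two copies lose `m + 1` classes each and the others are intact, then the intact ones
have the same colour. -/
theorem IsColoring.exists_isMono_of_two {m : ℕ} {α : Type*} {D : Finset (TwinClass (m + 1))}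
    {c : TwinClass (m + 1) → α} (hc : IsColoring D c) (hm : 1 ≤ m) {k j : ZMod 4} (hkj : j ≠ k)
    (hk : (BalancedHypercube.slice D k).card ≤ m + 1)
    (hz : ∀ l, l ≠ k → l ≠ j → (BalancedHypercube.slice D l).card = 0) :
    ∃ b, ∀ l, l ≠ k → l ≠ j → IsMono D c l b := by
  have hex : ∀ l, l ≠ k → l ≠ j → ∃ b, IsMono D c l b := by
    intro l h1 h2
    obtain ⟨b, hb⟩ := (hc.slice l).exists_eq (by rw [hz l h1 h2]; omega)
    exact ⟨b, fun x hx => hb x (mt mem_slice.1 hx)⟩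
  obtain ⟨n1, n2, n3⟩ := zmod_four_add_ne k
  have n12 : k + 1 ≠ k + 2 := by simpa using (by decide : (1 : ZMod 4) ≠ 2)
  have n13 : k + 1 ≠ k + 3 := by simpa using (by decide : (1 : ZMod 4) ≠ 3)
  have n23 : k + 2 ≠ k + 3 := by simpa using (by decide : (2 : ZMod 4) ≠ 3)
  rcases zmod_four_cases k j with rfl | rfl | rfl | rfl
  · exact absurd rfl hkj
  · obtain ⟨b, hb⟩ := hex (k + 2) n2 n12.symm
    obtain ⟨b', hb'⟩ := hex (k + 3) n3 n13.symm
    have e := IsMono.link hc (by ring) (by rw [hz _ n2 n12.symm]; omega)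
      (by rw [hz _ n3 n13.symm]; omega) hb hb'
    subst e
    refine ⟨b, fun l h1 h2 => ?_⟩
    rcases zmod_four_cases k l with rfl | rfl | rfl | rfl
    exacts [absurd rfl h1, absurd rfl h2, hb, hb']
  · obtain ⟨b, hb⟩ := hex (k + 1) n1 n12
    obtain ⟨b', hb'⟩ := hex (k + 3) n3 n23.symm
    -- The intact copies are opposite, so they are joined through copy `k`: a surviving edge there
    -- has its even end next to copy `k + 1` and its odd end next to copy `k + 3`.
    obtain ⟨x, hx, hA, hB⟩ := exists_not_mem_nbr_not_mem (BalancedHypercube.slice D k) (by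
      have := two_mul_lt_four_pow m; omega)
    have hz1 := not_mem_of_card_eq_zero (hz _ n1 n12) (nbr x none)
    have hz3 := not_mem_of_card_eq_zero (hz _ n3 n23.symm) (nbr (nbr x none) none)
    have hs1 : k + sgn x.1 = k + 1 := by rw [hx]; rfl
    have hs3 : k + sgn (nbr x none).1 = k + 3 := by rw [nbr_fst, hx]; rfl
    have e : b = b' := by
      rw [← hb _ hz1, ← hb' _ hz3, ← hs1, ← hs3, ← nbr_ins_zero, ← nbr_ins_zero]
      rw [← hs1, ← nbr_ins_zero] at hz1
      rw [← hs3, ← nbr_ins_zero] at hz3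
      rw [hc _ _ (mt mem_slice.2 hA) hz1, hc _ _ (mt mem_slice.2 hB) hz3]
      exact (hc.slice k x none hA hB).symm
    subst e
    refine ⟨b, fun l h1 h2 => ?_⟩
    rcases zmod_four_cases k l with rfl | rfl | rfl | rfl
    exacts [absurd rfl h1, hb, absurd rfl h2, hb']
  · obtain ⟨b, hb⟩ := hex (k + 1) n1 n13
    obtain ⟨b', hb'⟩ := hex (k + 2) n2 n23
    have e := IsMono.link hc (by ring) (by rw [hz _ n1 n13]; omega)
      (by rw [hz _ n2 n23]; omega) hb hb'
    subst e
    refine ⟨b, fun l h1 h2 => ?_⟩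
    rcases zmod_four_cases k l with rfl | rfl | rfl | rfl
    exacts [absurd rfl h1, hb, hb', absurd rfl h2]

theorem exists_sgn_ne {k j : ZMod 4} : ∃ p, k + sgn p ≠ j := by
  revert k j
  decide

/-- After the removal of at most `2m` classes, all but two of the others lie in one component. -/
theorem IsColoring.exists_small {m : ℕ} {α : Type*} {D : Finset (TwinClass m)}
    {c : TwinClass m → α} (hc : IsColoring D c) (hm : 2 ≤ m) (hD : D.card ≤ 2 * m) :
    ∃ b, ∀ x y z, x ∉ D → y ∉ D → z ∉ D → c x ≠ b → c y ≠ b → c z ≠ b →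
      x = y ∨ x = z ∨ y = z := by
  obtain ⟨m, rfl⟩ := Nat.exists_eq_add_of_le' (show 1 ≤ m by omega)
  have ih : ∀ k, (BalancedHypercube.slice D k).card ≤ m → ∃ b, IsMono D c k b := by
    intro k hk
    obtain ⟨b, hb⟩ := (hc.slice k).exists_eq hk
    exact ⟨b, fun x hx => hb x (mt mem_slice.1 hx)⟩
  by_cases hall : ∃ k, ∀ l, l ≠ k → (BalancedHypercube.slice D l).card ≤ m
  · obtain ⟨k, hk⟩ := hall
    obtain ⟨b, hb⟩ := exists_isMono_of_ne hc ih k hk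
    have hin : ∀ v, v ∉ D → c v ≠ b → ∃ x, v = ins k x := by
      intro v hv hvb
      obtain ⟨l, x, rfl⟩ := exists_ins v
      refine ⟨x, ?_⟩
      by_contra hl
      exact hvb (hb l (fun h => hl (by rw [h])) x hv)
    refine ⟨b, fun x y z hx hy hz hxb hyb hzb => ?_⟩
    obtain ⟨x, rfl⟩ := hin x hx hxb
    obtain ⟨y, rfl⟩ := hin y hy hyb
    obtain ⟨z, rfl⟩ := hin z hz hzb
    have h1 := hc.eq_of_fst_eq hD hb hx hxb hy hyb
    have h2 := hc.eq_of_fst_eq hD hb hx hxb hz hzb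
    have h3 := hc.eq_of_fst_eq hD hb hy hyb hz hzb
    -- At most one exceptional class of each parity exists.
    have h4 : x.1 = y.1 ∨ x.1 = z.1 ∨ y.1 = z.1 := by
      cases x.1 <;> cases y.1 <;> cases z.1 <;> simp
    rcases h4 with h | h | h
    · rw [h1 h]; simp
    · rw [h2 h]; simp
    · rw [h3 h]; simp
  · push Not at hall
    obtain ⟨k, hk0, hk⟩ := hall 0
    obtain ⟨j, hj, hj'⟩ := hall k
    -- Copies `k` and `j` each lose at least `m + 1` of at most `2 * (m + 1)` classes, so exactly `m
    -- + 1`, and the other copies are intact.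
    have hs := sum_card_slice_shift D k
    have hcards : (BalancedHypercube.slice D k).card ≤ m + 1 ∧
        (BalancedHypercube.slice D j).card ≤ m + 1 ∧
        ∀ l, l ≠ k → l ≠ j → (BalancedHypercube.slice D l).card = 0 := by
      rcases zmod_four_cases k j with rfl | rfl | rfl | rfl
      · exact absurd rfl hj
      all_goals
        refine ⟨by omega, by omega, fun l h1 h2 => ?_⟩
        rcases zmod_four_cases k l with rfl | rfl | rfl | rfl
        all_goals first | exact absurd rfl h1 | exact absurd rfl h2 | omega
    obtain ⟨hck, hcj, hz⟩ := hcards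
    obtain ⟨b, hb⟩ := hc.exists_isMono_of_two (by omega) hj hck hz
    have hin : ∀ v, v ∉ D → c v ≠ b → ∃ l x, (l = k ∨ l = j) ∧ v = ins l x := by
      intro v hv hvb
      obtain ⟨l, x, rfl⟩ := exists_ins v
      refine ⟨l, x, ?_, rfl⟩
      by_contra! hl
      exact hvb (hb l hl.1 hl.2 x hv)
    have huniq : ∀ l x y, (l = k ∨ l = j) → ins l x ∉ D → c (ins l x) ≠ b → ins l y ∉ D →
        c (ins l y) ≠ b → x = y := by
      rintro l x y (rfl | rfl) hx hxb hy hyb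
      · obtain ⟨p, hp⟩ := exists_sgn_ne (k := l) (j := j)
        exact hc.eq_of_isMono (by omega) hck (hz _ (sgn_ne _ _) hp) (hb _ (sgn_ne _ _) hp)
          hx hxb hy hyb
      · obtain ⟨p, hp⟩ := exists_sgn_ne (k := l) (j := k)
        exact hc.eq_of_isMono (by omega) hcj (hz _ hp (sgn_ne _ _)) (hb _ hp (sgn_ne _ _))
          hx hxb hy hyb
    refine ⟨b, fun x y z hx hy hz hxb hyb hzb => ?_⟩
    obtain ⟨l1, x, hl1, rfl⟩ := hin x hx hxb
    obtain ⟨l2, y, hl2, rfl⟩ := hin y hy hyb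
    obtain ⟨l3, z, hl3, rfl⟩ := hin z hz hzb
    have h4 : l1 = l2 ∨ l1 = l3 ∨ l2 = l3 := by
      rcases hl1 with rfl | rfl <;> rcases hl2 with rfl | rfl <;> rcases hl3 with rfl | rfl <;>
        simp
    rcases h4 with rfl | rfl | rfl
    · rw [huniq l1 x y hl1 hx hxb hy hyb]; simp
    · rw [huniq l1 x z hl1 hx hxb hz hzb]; simp
    · rw [huniq l2 y z hl2 hy hyb hz hzb]; simp

/-- If the removal of at most `2m` classes disconnects the others without isolating one of them,
then it cuts off an edge. -/
theorem IsColoring.exists_edge {m : ℕ} {α : Type*} {D : Finset (TwinClass m)}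
    {c : TwinClass m → α} (hc : IsColoring D c) (hm : 2 ≤ m) (hD : D.card ≤ 2 * m)
    (hiso : ∀ x, x ∉ D → ∃ t, nbr x t ∉ D) {x y : TwinClass m} (hx : x ∉ D) (hy : y ∉ D)
    (hxy : c x ≠ c y) :
    ∃ x t, ∀ s, s ≠ t → nbr x s ∈ D ∧ nbr (nbr x t) s ∈ D := by
  obtain ⟨b, hb⟩ := hc.exists_small hm hD
  obtain ⟨x, hx, hxb⟩ : ∃ x, x ∉ D ∧ c x ≠ b := by
    by_cases h : c x = b
    · exact ⟨y, hy, fun h' => hxy (h.trans h'.symm)⟩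
    · exact ⟨x, hx, h⟩
  have hne : ∀ (z : TwinClass m) t, nbr z t ≠ z := by
    intro z t h
    simpa [nbr] using congrArg Prod.fst h
  -- An exceptional class and one surviving neighbour already make up the two exceptions, so every
  -- other neighbour is deleted.
  have key : ∀ z t s, z ∉ D → c z ≠ b → nbr z t ∉ D → s ≠ t → nbr z s ∈ D := by
    intro z t s hz hzb ht hst
    by_contra hs
    rcases hb z (nbr z t) (nbr z s) hz ht hs hzb (by rwa [hc z t hz ht])
      (by rwa [hc z s hz hs]) with h | h | h
    · exact hne _ _ h.symm
    · exact hne _ _ h.symm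
    · exact hst (nbr_injective z h).symm
  obtain ⟨t, ht⟩ := hiso x hx
  refine ⟨x, t, fun s hst => ⟨key x t s hx hxb ht hst, ?_⟩⟩
  exact key (nbr x t) t s ht (by rwa [hc x t hx ht]) (by rwa [nbr_nbr]) hst

/-! ### The balanced hypercube as the doubled class graph. -/

/-- The twin class of a vertex. -/
def twinClass {m : ℕ} (v : Fin (m + 1) → ZMod 4) : TwinClass m :=
  (decide ((v 0).val % 2 = 1), Fin.tail v)

theorem parity_add {a e : ZMod 4} (he : e = 1 ∨ e = -1) :
    decide ((a + e).val % 2 = 1) = !decide (a.val % 2 = 1) := by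
  revert a e
  decide

theorem sub_of_parity {a b : ZMod 4} (h : decide (b.val % 2 = 1) = !decide (a.val % 2 = 1)) :
    b - a = 1 ∨ b - a = -1 := by
  revert a b
  decide

theorem neg_one_pow_eq (a : ZMod 4) :
    (-1 : ZMod 4) ^ a.val = if decide (a.val % 2 = 1) then -1 else 1 := by
  revert a
  decide

theorem isNeighbor_iff {m : ℕ} {u v : Fin (m + 1) → ZMod 4} :
    IsNeighbor u v ↔ ∃ t, twinClass v = nbr (twinClass u) t := by
  constructor
  · rintro ⟨e, he, rfl | ⟨i, hi, rfl⟩⟩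
    · refine ⟨none, ?_⟩
      simp only [twinClass, nbr, step, Function.update_self, parity_add he, Fin.tail_update_zero,
        sub_zero, add_zero, ite_self]
    · obtain ⟨j, rfl⟩ := Fin.exists_succ_eq.2 hi
      refine ⟨some j, ?_⟩
      simp only [twinClass, nbr, Function.update_of_ne hi.symm, Function.update_self,
        parity_add he, Fin.tail_update_succ, Fin.tail_update_zero, neg_one_pow_eq, Prod.mk.injEq,
        true_and]
      funext l
      by_cases hp : (u 0).val % 2 = 1 <;> by_cases hl : l = j
      · subst hl
        simp [step, Fin.tail, sub_eq_add_neg, hp]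
      · simp [step, hl, hp]
      · subst hl
        simp [step, Fin.tail, hp]
      · simp [step, hl, hp]
  · rintro ⟨t, ht⟩
    obtain ⟨h1, h2⟩ := Prod.mk.inj ht
    refine ⟨v 0 - u 0, sub_of_parity h1, ?_⟩
    rw [add_sub_cancel]
    cases t with
    | none =>
      left
      funext i
      refine Fin.cases ?_ (fun j => ?_) i
      · simp
      · have := congrFun h2 j
        rw [step_none, sub_zero, add_zero, ite_self] at this
        rw [Function.update_of_ne (Fin.succ_ne_zero j)]
        exact this
    | some k =>
      right
      refine ⟨k.succ, Fin.succ_ne_zero k, ?_⟩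
      funext i
      refine Fin.cases ?_ (fun j => ?_) i
      · simp [Function.update_of_ne (Fin.succ_ne_zero k).symm]
      · have := congrFun h2 j
        rw [neg_one_pow_eq]
        change v j.succ = _ at this
        rw [this]
        simp only [twinClass, step]
        by_cases hp : (u 0).val % 2 = 1 <;> by_cases hj : j = k
        · subst hj
          simp [Fin.tail, sub_eq_add_neg, hp]
        · simp [hj, Fin.tail, hp]
        · subst hj
          simp [Fin.tail, hp]
        · simp [hj, Fin.tail, hp]

/-- The two vertices of a twin class. -/
def twin {m : ℕ} (x : TwinClass m) (b : Bool) : Fin (m + 1) → ZMod 4 :=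
  Fin.cons ((if x.1 then 1 else 0) + if b then 2 else 0) x.2

theorem parity_twin (p b : Bool) :
    decide (((if p then 1 else 0) + if b then 2 else 0 : ZMod 4).val % 2 = 1) = p := by
  revert p b
  decide

theorem twinClass_twin {m : ℕ} (x : TwinClass m) (b : Bool) : twinClass (twin x b) = x := by
  obtain ⟨p, a⟩ := x
  simp only [twinClass, twin, Fin.cons_zero, Fin.tail_cons, Prod.mk.injEq, and_true]
  exact parity_twin p b

theorem eq_add_twin (a : ZMod 4) :
    ∃ b : Bool, a = (if decide (a.val % 2 = 1) then 1 else 0) + if b then 2 else 0 := by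
  revert a
  decide

theorem exists_twin {m : ℕ} (v : Fin (m + 1) → ZMod 4) : ∃ b, v = twin (twinClass v) b := by
  obtain ⟨b, hb⟩ := eq_add_twin (v 0)
  refine ⟨b, ?_⟩
  rw [twin, ← Fin.cons_self_tail v]
  exact congrArg (fun z => (Fin.cons z (Fin.tail v) : Fin (m + 1) → ZMod 4)) hb

theorem twin_inj {m : ℕ} {x y : TwinClass m} {a b : Bool} :
    twin x a = twin y b ↔ x = y ∧ a = b := by
  constructor
  · intro h
    have hxy : x = y := by rw [← twinClass_twin x a, h, twinClass_twin]
    subst hxy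
    refine ⟨rfl, ?_⟩
    have h0 := congrFun h 0
    simp only [twin, Fin.cons_zero, add_right_inj] at h0
    clear h
    revert a b
    decide
  · rintro ⟨rfl, rfl⟩
    rfl

/-- The vertices in a set of twin classes. -/
def fiber {m : ℕ} (A : Finset (TwinClass m)) : Finset (Fin (m + 1) → ZMod 4) :=
  Finset.univ.filter fun v => twinClass v ∈ A

theorem mem_fiber {m : ℕ} {A : Finset (TwinClass m)} {v : Fin (m + 1) → ZMod 4} :
    v ∈ fiber A ↔ twinClass v ∈ A := by
  simp [fiber]

theorem card_fiber {m : ℕ} (A : Finset (TwinClass m)) : (fiber A).card = 2 * A.card := by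
  have : fiber A = (A ×ˢ (Finset.univ : Finset Bool)).image fun p => twin p.1 p.2 := by
    ext v
    simp only [mem_fiber, Finset.mem_image, Finset.mem_product, Finset.mem_univ, and_true]
    constructor
    · intro h
      obtain ⟨b, hb⟩ := exists_twin v
      exact ⟨(_, b), h, hb.symm⟩
    · rintro ⟨⟨x, b⟩, hx, rfl⟩
      rwa [twinClass_twin]
  rw [this, Finset.card_image_of_injective, Finset.card_product]
  · simp [mul_comm]
  · rintro ⟨x, a⟩ ⟨y, b⟩ h
    simpa using twin_inj.1 h

/-! ### Intersections of stars with neighbourhoods. -/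

/-- The vertex set of a connected subgraph of a `K_{1,3}`. -/
def IsStarSet {m : ℕ} (X : Finset (Fin (m + 1) → ZMod 4)) : Prop :=
  X.card ≤ 4 ∧ ∃ c ∈ X, ∀ v ∈ X, v ≠ c → ∃ t, twinClass v = nbr (twinClass c) t

theorem IsStarSet.card_inter_nbrs_le {m : ℕ} {X : Finset (Fin (m + 1) → ZMod 4)}
    (hX : IsStarSet X) (x : TwinClass m) :
    (X ∩ fiber (nbrs x)).card ≤ 2 + (X ∩ fiber {x}).card := by
  obtain ⟨h4, c, hc, hadj⟩ := hX
  by_cases hcx : twinClass c = x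
  -- There may be three leaves next to `x`, but the centre then counts on the right-hand side.
  · have h1 : X ∩ fiber (nbrs x) ⊆ X.erase c := by
      intro v hv
      rw [Finset.mem_inter, mem_fiber, mem_nbrs] at hv
      obtain ⟨hv, t, ht⟩ := hv
      refine Finset.mem_erase.2 ⟨?_, hv⟩
      rintro rfl
      have := congrArg Prod.fst (ht.trans hcx)
      simp [nbr_fst] at this
    have h2 : 0 < (X ∩ fiber {x}).card :=
      Finset.card_pos.2 ⟨c, by simp [mem_fiber, hc, hcx]⟩
    have h3 := Finset.card_le_card h1
    have h5 := Finset.card_erase_add_one hc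
    omega
  · by_cases hcn : twinClass c ∈ nbrs x
    · obtain ⟨t, ht⟩ := mem_nbrs.1 hcn
      have h1 : X ∩ fiber (nbrs x) ⊆ {c} := by
        intro v hv
        rw [Finset.mem_inter, mem_fiber, mem_nbrs] at hv
        obtain ⟨hv, s, hs⟩ := hv
        rw [Finset.mem_singleton]
        by_contra hne
        obtain ⟨r, hr⟩ := hadj v hv hne
        rw [← ht, ← hs] at hr
        have := congrArg Prod.fst hr
        simp [nbr_fst] at this
      have := Finset.card_le_card h1
      simp only [Finset.card_singleton] at this
      omega
    -- Only leaves can lie next to `x`, and they lie in the at most one common neighbour class,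
    -- which has two vertices.
    · have h1 : X ∩ fiber (nbrs x) ⊆ fiber (nbrs (twinClass c) ∩ nbrs x) := by
        intro v hv
        rw [Finset.mem_inter, mem_fiber] at hv
        rw [mem_fiber, Finset.mem_inter]
        refine ⟨?_, hv.2⟩
        obtain ⟨t, ht⟩ := hadj v hv.1 (by rintro rfl; exact hcn hv.2)
        exact mem_nbrs.2 ⟨t, ht.symm⟩
      have h2 := Finset.card_le_card h1
      rw [card_fiber] at h2
      have := card_nbrs_inter hcx
      omega

/-- The classes adjacent to an edge of twin classes. -/
def edgeNbrs {m : ℕ} (x : TwinClass m) (t : Option (Fin m)) : Finset (TwinClass m) :=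
  (nbrs x).erase (nbr x t) ∪ (nbrs (nbr x t)).erase x

theorem card_edgeNbrs {m : ℕ} (x : TwinClass m) (t : Option (Fin m)) :
    (edgeNbrs x t).card = 2 * m := by
  rw [edgeNbrs, Finset.card_union_of_disjoint, Finset.card_erase_of_mem, Finset.card_erase_of_mem,
    card_nbrs, card_nbrs]
  · omega
  · exact mem_nbrs.2 ⟨t, nbr_nbr _ _⟩
  · exact mem_nbrs.2 ⟨t, rfl⟩
  · rw [Finset.disjoint_left]
    intro y hy hy'
    obtain ⟨s, rfl⟩ := mem_nbrs.1 (Finset.mem_of_mem_erase hy)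
    obtain ⟨r, hr⟩ := mem_nbrs.1 (Finset.mem_of_mem_erase hy')
    have := congrArg Prod.fst hr
    simp [nbr_fst] at this

theorem mem_edgeNbrs {m : ℕ} {x y : TwinClass m} {t : Option (Fin m)} :
    y ∈ edgeNbrs x t ↔ ∃ s, s ≠ t ∧ (y = nbr x s ∨ y = nbr (nbr x t) s) := by
  simp only [edgeNbrs, Finset.mem_union, Finset.mem_erase, mem_nbrs]
  constructor
  · rintro (⟨h, s, rfl⟩ | ⟨h, s, rfl⟩)
    · exact ⟨s, by rintro rfl; exact h rfl, Or.inl rfl⟩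
    · exact ⟨s, by rintro rfl; exact h (nbr_nbr _ _), Or.inr rfl⟩
  · rintro ⟨s, hs, rfl | rfl⟩
    · exact Or.inl ⟨fun h => hs (nbr_injective _ h), s, rfl⟩
    · refine Or.inr ⟨fun h => hs ?_, s, rfl⟩
      apply nbr_injective (nbr x t)
      rw [h, nbr_nbr]

/-- Equality would close a 4-cycle through `x`, `nbr x s` and `nbr x t`. -/
theorem nbr_nbr_ne {m : ℕ} {x : TwinClass m} {s t r s' : Option (Fin m)} (hs : s ≠ t)
    (hs' : s' ≠ t) : nbr (nbr x s) r ≠ nbr (nbr x t) s' := by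
  intro h
  refine hs' (eq_of_nbr_eq_nbr (x := nbr x t) (y := nbr x s) ?_ h.symm (t' := t) (s' := s) ?_)
  · exact fun h => hs (nbr_injective _ h).symm
  · rw [nbr_nbr, nbr_nbr]

/-- The classes adjacent to an edge are pairwise non-adjacent. -/
theorem nbr_not_mem_edgeNbrs {m : ℕ} {x y : TwinClass m} {t : Option (Fin m)}
    (hy : y ∈ edgeNbrs x t) (r : Option (Fin m)) : nbr y r ∉ edgeNbrs x t := by
  intro h
  obtain ⟨s, hs, hy⟩ := mem_edgeNbrs.1 hy
  obtain ⟨s', hs', h⟩ := mem_edgeNbrs.1 h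
  rcases hy with rfl | rfl <;> rcases h with h | h
  · simpa [nbr_fst] using congrArg Prod.fst h
  · exact nbr_nbr_ne hs hs' h
  · exact nbr_nbr_ne hs' hs (eq_nbr_comm.1 h.symm).symm
  · simpa [nbr_fst] using congrArg Prod.fst h

theorem IsStarSet.card_inter_edgeNbrs_le {m : ℕ} {X : Finset (Fin (m + 1) → ZMod 4)}
    (hX : IsStarSet X) (x : TwinClass m) (t : Option (Fin m)) :
    (X ∩ fiber (edgeNbrs x t)).card ≤ 3 := by
  obtain ⟨h4, c, hc, hadj⟩ := hX
  by_contra! hcon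
  -- Otherwise all four vertices, and so an edge of the star, lie in an independent set.
  have hsub : X ⊆ fiber (edgeNbrs x t) := by
    rw [← Finset.inter_eq_left]
    exact Finset.eq_of_subset_of_card_le Finset.inter_subset_left (by omega)
  rw [Finset.inter_eq_left.2 hsub] at hcon
  obtain ⟨v, hv, hvc⟩ := Finset.exists_mem_ne (show 1 < X.card by omega) c
  obtain ⟨r, hr⟩ := hadj v hv hvc
  have := mem_fiber.1 (hsub hv)
  rw [hr] at this
  exact nbr_not_mem_edgeNbrs (mem_fiber.1 (hsub hc)) r this

/-! ### The lower bound for families of star sets. -/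

/-- At most `m` stars do not disconnect `BH_(m+1)`. -/
theorem eq_of_isStarSet {m : ℕ} (hm : 1 ≤ m) {ι : Type*} {F : Finset ι}
    {X : ι → Finset (Fin (m + 1) → ZMod 4)} (hF : F.card ≤ m) (hX : ∀ i ∈ F, IsStarSet (X i))
    (hdisj : (F : Set ι).PairwiseDisjoint X) {c : (Fin (m + 1) → ZMod 4) → Prop}
    (hc : ∀ u v, u ∉ F.biUnion X → v ∉ F.biUnion X → IsNeighbor u v → (c u ↔ c v))
    {u v : Fin (m + 1) → ZMod 4} (hu : u ∉ F.biUnion X) (hv : v ∉ F.biUnion X) :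
    c u ↔ c v := by
  classical
  set S := F.biUnion X with hS
  have hcard : ∀ A : Finset (Fin (m + 1) → ZMod 4), (S ∩ A).card = ∑ i ∈ F, (X i ∩ A).card := by
    intro A
    rw [hS, Finset.biUnion_inter, Finset.card_biUnion]
    intro i hi j hj hij
    exact (hdisj hi hj hij).mono Finset.inter_subset_left Finset.inter_subset_left
  let D : Finset (TwinClass m) := Finset.univ.filter fun x => ∀ w, twinClass w = x → w ∈ S
  have hDmem : ∀ x, x ∉ D ↔ ∃ w, w ∉ S ∧ twinClass w = x := by
    intro x
    simp only [D, Finset.mem_filter, Finset.mem_univ, true_and]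
    push Not
    exact exists_congr fun w => and_comm
  have hmemD : ∀ w, w ∉ S → twinClass w ∉ D := fun w hw => (hDmem _).2 ⟨w, hw, rfl⟩
  have hDS : ∀ A, A ⊆ D → S ∩ fiber A = fiber A := by
    intro A hA
    rw [Finset.inter_eq_right]
    intro w hw
    by_contra hn
    exact hmemD w hn (hA (mem_fiber.1 hw))
  have hD : 2 * D.card ≤ 4 * m := by
    rw [← card_fiber, ← hDS D subset_rfl, hcard]
    calc ∑ i ∈ F, (X i ∩ fiber D).card ≤ ∑ i ∈ F, 4 :=
          Finset.sum_le_sum fun i hi =>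
            (Finset.card_le_card Finset.inter_subset_left).trans (hX i hi).1
      _ ≤ 4 * m := by rw [Finset.sum_const, smul_eq_mul]; omega
  have hiso : ∀ x, x ∉ D → ∃ t, nbr x t ∉ D := by
    intro x hx
    by_contra! hcon
    have h1 : nbrs x ⊆ D := by
      intro y hy
      obtain ⟨t, rfl⟩ := mem_nbrs.1 hy
      exact hcon t
    -- A surviving class has at most one covered vertex, so the right-hand side is at most `2 * m +
    -- 1`.
    have h2 : 2 * (m + 1) ≤ 2 * m + (S ∩ fiber {x}).card := by
      calc 2 * (m + 1) = (S ∩ fiber (nbrs x)).card := by rw [hDS _ h1, card_fiber, card_nbrs]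
        _ = ∑ i ∈ F, (X i ∩ fiber (nbrs x)).card := hcard _
        _ ≤ ∑ i ∈ F, (2 + (X i ∩ fiber {x}).card) :=
          Finset.sum_le_sum fun i hi => (hX i hi).card_inter_nbrs_le x
        _ = F.card * 2 + (S ∩ fiber {x}).card := by
          rw [Finset.sum_add_distrib, Finset.sum_const, smul_eq_mul, hcard]
        _ ≤ _ := by omega
    obtain ⟨w, hw, hwx⟩ := (hDmem x).1 hx
    have h3 : (S ∩ fiber {x}).card < (fiber {x}).card := by
      apply Finset.card_lt_card
      refine ⟨Finset.inter_subset_right, fun h => hw ?_⟩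
      exact Finset.mem_of_mem_inter_left (h (mem_fiber.2 (by simp [hwx])))
    rw [card_fiber, Finset.card_singleton] at h3
    omega
  -- Surviving twins share a surviving neighbour, so `c` descends to the classes.
  have htwin : ∀ u v, u ∉ S → v ∉ S → twinClass u = twinClass v → (c u ↔ c v) := by
    intro u v hu hv huv
    obtain ⟨t, ht⟩ := hiso _ (hmemD u hu)
    obtain ⟨w, hw, hwt⟩ := (hDmem _).1 ht
    rw [hc u w hu hw (isNeighbor_iff.2 ⟨t, hwt⟩),
      hc v w hv hw (isNeighbor_iff.2 ⟨t, by rw [hwt, huv]⟩)]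
  let c' : TwinClass m → Prop := fun x => ∃ w, w ∉ S ∧ twinClass w = x ∧ c w
  have hc' : ∀ w, w ∉ S → c' (twinClass w) = c w := by
    intro w hw
    refine propext ⟨?_, fun h => ⟨w, hw, rfl, h⟩⟩
    rintro ⟨w', hw', h, hcw⟩
    exact (htwin _ _ hw' hw h).1 hcw
  have hcol : IsColoring D c' := by
    intro x t hx ht
    obtain ⟨u, hu, rfl⟩ := (hDmem x).1 hx
    obtain ⟨v, hv, hvt⟩ := (hDmem _).1 ht
    rw [← hvt, hc' u hu, hc' v hv]
    exact propext (hc u v hu hv (isNeighbor_iff.2 ⟨t, hvt⟩)).symm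
  by_contra hne
  have hne' : c' (twinClass u) ≠ c' (twinClass v) := by
    rw [hc' u hu, hc' v hv]
    exact fun h => hne (iff_of_eq h)
  rcases Nat.lt_or_ge 1 m with hm2 | hm1
  · obtain ⟨x, t, hxt⟩ := hcol.exists_edge hm2 (by omega) hiso (hmemD u hu) (hmemD v hv) hne'
    have h1 : edgeNbrs x t ⊆ D := by
      intro y hy
      obtain ⟨s, hs, rfl | rfl⟩ := mem_edgeNbrs.1 hy
      exacts [(hxt s hs).1, (hxt s hs).2]
    have h2 : 2 * (2 * m) ≤ 3 * m := by
      calc 2 * (2 * m) = (S ∩ fiber (edgeNbrs x t)).card := by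
            rw [hDS _ h1, card_fiber, card_edgeNbrs]
        _ = ∑ i ∈ F, (X i ∩ fiber (edgeNbrs x t)).card := hcard _
        _ ≤ ∑ i ∈ F, 3 := Finset.sum_le_sum fun i hi => (hX i hi).card_inter_edgeNbrs_le x t
        _ ≤ 3 * m := by rw [Finset.sum_const, smul_eq_mul]; omega
    omega
  · obtain rfl : m = 1 := by omega
    -- There is only one star. If the class of its centre were fully covered, the twin of the centre
    -- would be a leaf, but twins are not adjacent.
    have hle : ∀ i ∈ F, (X i ∩ fiber D).card ≤ 3 := by
      intro i hi
      obtain ⟨h4, z, hz, hadj⟩ := hX i hi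
      have hsub : X i ∩ fiber D ⊆ (X i).erase z := by
        intro w hw
        refine Finset.mem_erase.2 ⟨?_, Finset.mem_of_mem_inter_left hw⟩
        rintro rfl
        obtain ⟨b, hb⟩ := exists_twin w
        have hmem : twin (twinClass w) (!b) ∈ S ∩ fiber D := by
          rw [hDS D subset_rfl, mem_fiber, twinClass_twin]
          exact mem_fiber.1 (Finset.mem_of_mem_inter_right hw)
        obtain ⟨j, hj, hjm⟩ := Finset.mem_biUnion.1 (Finset.mem_of_mem_inter_left hmem)
        obtain rfl : j = i := Finset.card_le_one.1 hF j hj i hi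
        obtain ⟨t, ht⟩ := hadj _ hjm (by
          intro h
          have := twin_inj.1 (h.trans hb)
          simp at this)
        rw [twinClass_twin] at ht
        simpa [nbr_fst] using congrArg Prod.fst ht
      have := Finset.card_le_card hsub
      have := Finset.card_erase_add_one hz
      omega
    have h3 : 2 * D.card ≤ 3 := by
      rw [← card_fiber, ← hDS D subset_rfl, hcard]
      calc ∑ i ∈ F, (X i ∩ fiber D).card ≤ ∑ i ∈ F, 3 := Finset.sum_le_sum hle
        _ ≤ 3 := by rw [Finset.sum_const, smul_eq_mul]; omega
    obtain ⟨b, hb⟩ := hcol.exists_eq (by omega)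
    exact hne' ((hb _ (hmemD u hu)).trans (hb _ (hmemD v hv)).symm)

end BalancedHypercube

/-! ### Connected subgraphs of `K_{1,3}`. -/

namespace StructureConnectivity

/-- A connected subgraph of `K_{1,3}` is a star. -/
theorem exists_center (S : (completeBipartiteGraph (Fin 1) (Fin 3)).Subgraph) (hS : S.Connected) :
    ∃ s ∈ S.verts, ∀ w ∈ S.verts, w ≠ s → S.Adj s w := by
  have key : ∀ a b, a ∈ S.verts → b ∈ S.verts → a ≠ b → ∃ z, S.Adj a z := by
    intro a b ha hb hab
    have : Nontrivial S.verts := ⟨⟨⟨a, ha⟩, ⟨b, hb⟩, fun h => hab (congrArg Subtype.val h)⟩⟩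
    obtain ⟨z, hz⟩ := hS.coe.preconnected.exists_adj_of_nontrivial ⟨a, ha⟩
    exact ⟨z, hz⟩
  by_cases h0 : Sum.inl 0 ∈ S.verts
  · refine ⟨_, h0, fun w hw hne => ?_⟩
    obtain ⟨z, hz⟩ := key w _ hw h0 hne
    rcases w with w | w
    · exact absurd (congrArg Sum.inl (Subsingleton.elim w 0)) hne
    · rcases z with z | z
      · rw [Subsingleton.elim 0 z]
        exact hz.symm
      · simpa using hz.adj_sub
  -- Without the centre of `K_{1,3}` no edges are left, so connectedness leaves a single vertex.
  · have hr : ∀ a, a ∈ S.verts → ∃ i, a = Sum.inr i := by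
      rintro (i | i) ha
      · exact absurd (Subsingleton.elim i 0 ▸ ha) h0
      · exact ⟨i, rfl⟩
    obtain ⟨s, hs⟩ := (SimpleGraph.Subgraph.connected_iff.1 hS).2
    refine ⟨s, hs, fun w hw hne => ?_⟩
    obtain ⟨z, hz⟩ := key s w hs hw hne.symm
    obtain ⟨i, rfl⟩ := hr s hs
    obtain ⟨j, rfl⟩ := hr z (S.edge_vert hz.symm)
    simpa using hz.adj_sub

theorem exists_center_of_iso {V : Type*} {G : SimpleGraph V} {T : G.Subgraph}
    {S : (completeBipartiteGraph (Fin 1) (Fin 3)).Subgraph} (hS : S.Connected)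
    (e : T.coe ≃g S.coe) : ∃ c ∈ T.verts, ∀ v ∈ T.verts, v ≠ c → G.Adj c v := by
  obtain ⟨s, hs, hadj⟩ := exists_center S hS
  refine ⟨e.symm ⟨s, hs⟩, Subtype.coe_prop _, fun v hv hne => ?_⟩
  have h1 : (e ⟨v, hv⟩ : Fin 1 ⊕ Fin 3) ≠ s := by
    intro h
    apply hne
    have h2 : e ⟨v, hv⟩ = ⟨s, hs⟩ := Subtype.ext h
    rw [← h2, RelIso.symm_apply_apply]
  have h3 : S.coe.Adj ⟨s, hs⟩ (e ⟨v, hv⟩) := hadj _ (Subtype.coe_prop _) h1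
  have h4 := e.symm.map_adj_iff.2 h3
  rw [RelIso.symm_apply_apply] at h4
  exact SimpleGraph.Subgraph.Adj.adj_sub h4

theorem card_verts_le_of_iso {V : Type*} {G : SimpleGraph V} {T : G.Subgraph}
    {S : (completeBipartiteGraph (Fin 1) (Fin 3)).Subgraph} (e : T.coe ≃g S.coe) :
    Nat.card T.verts ≤ 4 := by
  rw [Nat.card_congr e.toEquiv]
  refine (Nat.card_le_card_of_injective _ Subtype.val_injective).trans ?_
  simp

end StructureConnectivity

/-! ### The lower bound for substructure cuts. -/

namespace BalancedHypercube

open StructureConnectivity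

theorem le_encard_of_isSubstructureCut {m : ℕ} (hm : 1 ≤ m) {F : Set (BH (m + 1)).Subgraph}
    (hF : IsSubstructureCut (BH (m + 1)) (completeBipartiteGraph (Fin 1) (Fin 3)) F) :
    ((m + 1 : ℕ) : ℕ∞) ≤ F.encard := by
  classical
  by_contra! hlt
  have hfin : F.Finite := Set.finite_of_encard_le_coe hlt.le
  rw [hfin.encard_eq_coe_toFinset_card, Nat.cast_lt] at hlt
  let X : (BH (m + 1)).Subgraph → Finset (Fin (m + 1) → ZMod 4) := fun T => T.verts.toFinset
  have hX : ∀ T ∈ hfin.toFinset, IsStarSet (X T) := by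
    intro T hT
    obtain ⟨S, hS, ⟨e⟩⟩ := hF.iso_subgraph T (hfin.mem_toFinset.1 hT)
    constructor
    · have := card_verts_le_of_iso e
      rwa [Nat.card_eq_card_toFinset] at this
    · obtain ⟨c, hc, hadj⟩ := exists_center_of_iso hS e
      refine ⟨c, Set.mem_toFinset.2 hc, fun v hv hne => ?_⟩
      exact isNeighbor_iff.1 (hadj v (Set.mem_toFinset.1 hv) hne)
  have hdisj : (hfin.toFinset : Set (BH (m + 1)).Subgraph).PairwiseDisjoint X := by
    intro T hT T' hT' hne
    rw [hfin.coe_toFinset] at hT hT'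
    exact Set.disjoint_toFinset.2 (hF.disjoint hT hT' hne)
  have hmem : ∀ v, v ∈ hfin.toFinset.biUnion X ↔ v ∈ ⋃ T ∈ F, T.verts := by
    intro v
    simp [X]
  rcases hF.cut with hcut | hcut
  · apply hcut
    rintro ⟨u, hu⟩ ⟨v, hv⟩
    -- The colour records whether a vertex is reachable from `u`.
    let c : (Fin (m + 1) → ZMod 4) → Prop := fun w =>
      ∃ h : w ∈ (⋃ T ∈ F, T.verts)ᶜ,
        ((BH (m + 1)).induce (⋃ T ∈ F, T.verts)ᶜ).Reachable ⟨u, hu⟩ ⟨w, h⟩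
    have hc : ∀ u v, u ∉ hfin.toFinset.biUnion X → v ∉ hfin.toFinset.biUnion X →
        IsNeighbor u v → (c u ↔ c v) := by
      intro a b ha hb hab
      rw [hmem] at ha hb
      have hadj : ((BH (m + 1)).induce (⋃ T ∈ F, T.verts)ᶜ).Adj ⟨a, ha⟩ ⟨b, hb⟩ := hab
      constructor
      · rintro ⟨_, h⟩
        exact ⟨hb, h.trans hadj.reachable⟩
      · rintro ⟨_, h⟩
        exact ⟨ha, h.trans hadj.symm.reachable⟩
    have := eq_of_isStarSet hm (Nat.lt_succ_iff.1 hlt) hX hdisj hc (mt (hmem u).1 hu)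
      (mt (hmem v).1 hv)
    exact (this.1 ⟨hu, SimpleGraph.Reachable.refl _⟩).2
  -- At most `4 * m` of the `4 ^ (m + 1)` vertices are covered, so at least two survive.
  · have h1 : (hfin.toFinset.biUnion X).card ≤ 4 * m := by
      calc (hfin.toFinset.biUnion X).card ≤ hfin.toFinset.card * 4 :=
            Finset.card_biUnion_le_card_mul _ _ _ fun T hT => (hX T hT).1
        _ ≤ 4 * m := by omega
    have h2 : ((hfin.toFinset.biUnion X)ᶜ).card ≤ 1 := by
      rw [Finset.card_le_one]
      intro a ha b hb
      rw [Finset.mem_compl, hmem] at ha hb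
      exact hcut ha hb
    have h3 := Finset.card_add_card_compl (hfin.toFinset.biUnion X)
    rw [Fintype.card_fun, ZMod.card, Fintype.card_fin, pow_succ] at h3
    have := two_mul_lt_four_pow m
    omega

/-! ### The upper bound: isolating a twin class with cherries. -/

/-- The copy of `K_{1,2}` with a centre in the class `nbr y t` and the two vertices of the class `y` as leaves. -/
def cherry {m : ℕ} (y : TwinClass m) (t : Option (Fin m)) :
    SimpleGraph.Copy (completeBipartiteGraph Unit Bool) (BH (m + 1)) where
  toHom :=
    { toFun := Sum.elim (fun _ => twin (nbr y t) false) (twin y)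
      map_rel' := by
        rintro (a | a) (b | b) h
        · simp at h
        · exact isNeighbor_iff.2 ⟨t, by simp [twinClass_twin, nbr_nbr]⟩
        · exact isNeighbor_iff.2 ⟨t, by simp [twinClass_twin]⟩
        · simp at h }
  injective' := by
    rintro (a | a) (b | b) h
    · rfl
    · simpa [nbr] using congrArg Prod.fst (twin_inj.1 h).1
    · simpa [nbr] using congrArg Prod.fst (twin_inj.1 h).1
    · exact congrArg Sum.inr (twin_inj.1 h).2

theorem mem_verts_cherry {m : ℕ} {y : TwinClass m} {t : Option (Fin m)}
    {v : Fin (m + 1) → ZMod 4} :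
    v ∈ (cherry y t).toSubgraph.verts ↔ v = twin (nbr y t) false ∨ twinClass v = y := by
  constructor
  · rintro ⟨a | a, -, rfl⟩
    · exact Or.inl rfl
    · exact Or.inr (twinClass_twin _ _)
  · rintro (rfl | rfl)
    · exact ⟨Sum.inl (), trivial, rfl⟩
    · obtain ⟨b, hb⟩ := exists_twin v
      exact ⟨Sum.inr b, trivial, hb.symm⟩

/-- A copy of `K_{1,2}` in `K_{1,3}`. -/
def cherryCopy : SimpleGraph.Copy (completeBipartiteGraph Unit Bool)
    (completeBipartiteGraph (Fin 1) (Fin 3)) where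
  toHom :=
    { toFun := Sum.map (fun _ => 0) fun b => if b then 1 else 0
      map_rel' := by
        rintro (a | a) (b | b) h <;> simp at h ⊢ }
  injective' := by
    intro a b
    revert a b
    decide

theorem connected_cherry : (completeBipartiteGraph Unit Bool).Connected := by
  have h : ∀ a, (completeBipartiteGraph Unit Bool).Reachable (Sum.inl ()) a := by
    rintro (a | a)
    · rfl
    · exact SimpleGraph.Adj.reachable (by simp)
  have : Nonempty (Unit ⊕ Bool) := ⟨Sum.inl ()⟩
  exact ⟨fun a b => (h a).symm.trans (h b)⟩

theorem connected_toSubgraph {V W : Type*} {A : SimpleGraph V} {G : SimpleGraph W}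
    (hA : A.Connected) (f : SimpleGraph.Copy A G) : f.toSubgraph.Connected :=
  ⟨f.isoToSubgraph.connected_iff.1 hA⟩

theorem exists_isSubstructureCut {m : ℕ} (hm : 1 ≤ m) :
    ∃ F : Set (BH (m + 1)).Subgraph,
      IsSubstructureCut (BH (m + 1)) (completeBipartiteGraph (Fin 1) (Fin 3)) F ∧
        F.encard ≤ ((m + 1 : ℕ) : ℕ∞) := by
  -- The direction `σ t ≠ t` keeps the centre of the `t`-th cherry outside `q`; it exists because `1
  -- ≤ m`.
  obtain ⟨σ, hσ⟩ : ∃ σ : Option (Fin m) → Option (Fin m), ∀ t, σ t ≠ t :=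
    ⟨fun t => t.elim (some ⟨0, hm⟩) fun _ => none, by rintro (_ | _) <;> simp⟩
  let q : TwinClass m := (false, 0)
  let T : Option (Fin m) → (BH (m + 1)).Subgraph := fun t =>
    (cherry (nbr q t) (σ t)).toSubgraph
  have hT : ∀ t v, v ∈ (T t).verts ↔
      v = twin (nbr (nbr q t) (σ t)) false ∨ twinClass v = nbr q t :=
    fun _ _ => mem_verts_cherry
  have hq : ∀ b, twin q b ∈ (⋃ t ∈ Set.range T, t.verts)ᶜ := by
    intro b h
    simp only [Set.mem_range, Set.iUnion_exists, Set.iUnion_iUnion_eq', Set.mem_iUnion, hT,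
      twinClass_twin, twin_inj] at h
    obtain ⟨t, h | h⟩ := h
    · apply hσ t
      apply nbr_injective (nbr q t)
      rw [← h.1, nbr_nbr]
    · simpa [nbr] using congrArg Prod.fst h
  refine ⟨Set.range T, ⟨?_, ?_, ?_, ?_⟩, ?_⟩
  · rintro _ ⟨t, rfl⟩
    exact connected_toSubgraph connected_cherry _
  · rintro _ ⟨t, rfl⟩
    exact ⟨cherryCopy.toSubgraph, connected_toSubgraph connected_cherry _,
      ⟨(cherry (nbr q t) (σ t)).isoToSubgraph.symm.trans cherryCopy.isoToSubgraph⟩⟩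
  · rintro _ ⟨t, rfl⟩ _ ⟨s, rfl⟩ hne
    have hts : t ≠ s := by rintro rfl; exact hne rfl
    rw [Set.disjoint_left]
    intro v hv hv'
    rw [hT] at hv hv'
    rcases hv with rfl | hv <;> rcases hv' with h | h
    -- A common centre of two cherries would close a 4-cycle through `q`.
    · refine hσ t (eq_of_nbr_eq_nbr (fun h => hts (nbr_injective q h)) (twin_inj.1 h).1
        (t' := t) (s' := s) ?_)
      rw [nbr_nbr, nbr_nbr]
    · rw [twinClass_twin] at h
      simpa [nbr] using congrArg Prod.fst h
    · rw [h, twinClass_twin] at hv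
      simpa [nbr] using congrArg Prod.fst hv
    · exact hts (nbr_injective q (hv.symm.trans h))
  · left
    intro hpre
    -- Both vertices of `q` survive, while every neighbour of `q` is removed.
    have : Nontrivial ↥(⋃ t ∈ Set.range T, t.verts)ᶜ :=
      ⟨⟨⟨twin q false, hq false⟩, ⟨twin q true, hq true⟩, fun h => by
        simpa using (twin_inj.1 (congrArg Subtype.val h)).2⟩⟩
    obtain ⟨⟨z, hz⟩, hadj⟩ := hpre.exists_adj_of_nontrivial ⟨twin q false, hq false⟩
    obtain ⟨t, ht⟩ := isNeighbor_iff.1 (show IsNeighbor (twin q false) z from hadj)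
    rw [twinClass_twin] at ht
    exact hz (Set.mem_biUnion (Set.mem_range_self t) ((hT t z).2 (Or.inr ht)))
  · rw [← Set.image_univ]
    refine (Set.encard_image_le _ _).trans ?_
    rw [Set.encard_univ, ENat.card_eq_coe_fintype_card]
    simp

end BalancedHypercube

/-- `κˢ(BH_n; K_{1,3}) = n` for all `n ≥ 2`. -/
theorem mainTheorem6 (n : ℕ) [NeZero n] (hn : 2 ≤ n) :
    StructureConnectivity.substructureConnectivity (BalancedHypercube.BH n)
      (completeBipartiteGraph (Fin 1) (Fin 3)) = (n : ℕ∞) := by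
  obtain ⟨m, rfl⟩ := Nat.exists_eq_add_of_le' (show 1 ≤ n by omega)
  have hm : 1 ≤ m := by omega
  apply le_antisymm
  · obtain ⟨F, hF, hcard⟩ := BalancedHypercube.exists_isSubstructureCut hm
    exact (iInf₂_le F hF).trans hcard
  · exact le_iInf₂ fun F hF => BalancedHypercube.le_encard_of_isSubstructureCut hm hF
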